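/- For positive integers $a,b,c$, a magic rectangle set $\mathrm{MRS}(a,b;c)$ is a collection of $c$ arrays of size $a\times b$ whose entries are the elements of $\{1,2,\ldots,abc\}$, each appearing exactly once in the whole collection, such that all row sums in all the arrays are equal to one constant $\delta$ and all column sums in all the arrays are equal to one constant $\eta$. For a finite Abelian group $\Gamma$ of order $abc$, a $\Gamma$-magic rectangle set $\mathrm{MRS}_\Gamma(a,b;c)$ is a collection of $c$ arrays of size $a\times b$ whose entries are the elements of $\Gamma$, each appearing exactly once in the whole collection, such that all row sums in all the arrays are equal to one constant $\omega\in\Gamma$ and all column sums in all the arrays are equal to one constant $\delta\in\Gamma$. **Theorem.** Let $a>1$, $b\geq 4$ and $c\ge 1$ be integers. If a magic rectangle set $\mathrm{MRS}(a,b;c)$ exists, then a $\Gamma$-magic rectangle set $\mathrm{MRS}_\Gamma(a,b;c)$ exists for every Abelian group $\Gamma$ of order $abc$. -/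

import Mathlib

/-- `M` is a magic rectangle set MRS(a, b; c): `c` arrays of size `a × b`
(`M s i j` is the entry in row `i` and column `j` of the `s`-th array) whose entries are the
elements of `{1, 2, …, abc}`, each appearing exactly once, with all row sums in all arrays equal
to one constant and all column sums in all arrays equal to one constant. -/
structure IsMagicRectangleSet (a b c : ℕ) (M : Fin c → Fin a → Fin b → ℕ) : Prop where
  bijOn : Set.BijOn (fun p : Fin c × Fin a × Fin b => M p.1 p.2.1 p.2.2)
    Set.univ (Set.Icc 1 (a * b * c))
  rowSum : ∃ δ : ℕ, ∀ (s : Fin c) (i : Fin a), ∑ j : Fin b, M s i j = δ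
  colSum : ∃ η : ℕ, ∀ (s : Fin c) (j : Fin b), ∑ i : Fin a, M s i j = η

/-- `M` is a `Γ`-magic rectangle set MRS_Γ(a, b; c): `c` arrays of size `a × b` whose entries are
the elements of `Γ`, each appearing exactly once, with all row sums in all arrays equal to one
constant and all column sums in all arrays equal to one constant. -/
structure IsGroupMagicRectangleSet (Γ : Type*) [AddCommGroup Γ] (a b c : ℕ)
    (M : Fin c → Fin a → Fin b → Γ) : Prop where
  bijective : Function.Bijective (fun p : Fin c × Fin a × Fin b => M p.1 p.2.1 p.2.2)
  rowSum : ∃ ω : Γ, ∀ (s : Fin c) (i : Fin a), ∑ j : Fin b, M s i j = ω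
  colSum : ∃ δ : Γ, ∀ (s : Fin c) (j : Fin b), ∑ i : Fin a, M s i j = δ

/-! Summing all entries of the integer set by rows and by columns forces `a`, `b` both even, or `a`,
`b`, `c` all odd. Tiling large arrays by small ones (`exists_blocks`) then leaves two kinds of small
array to build over every Abelian `Γ` of the right order.

Even case: 2 × 2 arrays are the orbits of a free Klein four-group action on `Γ`, generated by `x ↦ x
+ t` and `x ↦ d - x`.

Odd case: p × q arrays with p, q odd primes, by induction on the prime factors of `c`. A surjection
of `Γ` onto `ZMod r` reduces to its kernel, and a Kotzig array distributes the cosets over the cells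
without changing row or column sums (`exists_of_ker`). A single array over a group of order pq is
given by explicit formulas, for p = q and p ≠ q separately. -/

/-! ### Reindexing and tiling -/

section Indexing

variable {Γ : Type*} [AddCommGroup Γ]

/-- A magic rectangle set over `Γ` may be indexed by arbitrary finite types of the right sizes. -/
theorem exists_isGroupMagicRectangleSet_of_bijective [Finite Γ] {κ α β : Type*} [Finite κ]
    [Fintype α] [Fintype β] {a b c : ℕ} (hα : Nat.card α = a) (hβ : Nat.card β = b)
    (hΓ : Nat.card Γ = a * b * c) (M : κ → α → β → Γ)
    (hM : Function.Bijective fun p : κ × α × β => M p.1 p.2.1 p.2.2)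
    {ω δ : Γ} (hω : ∀ s i, ∑ j, M s i j = ω) (hδ : ∀ s j, ∑ i, M s i j = δ) :
    ∃ N : Fin c → Fin a → Fin b → Γ, IsGroupMagicRectangleSet Γ a b c N := by
  have hcard := Nat.card_congr (Equiv.ofBijective _ hM)
  rw [Nat.card_prod, Nat.card_prod, hα, hβ, hΓ, mul_comm] at hcard
  have hpos : 0 < a * b * c := hΓ ▸ Nat.card_pos
  have hκ : Nat.card κ = c := Nat.eq_of_mul_eq_mul_left (Nat.pos_of_mul_pos_right hpos) hcard
  let eα : Fin a ≃ α := (Finite.equivFinOfCardEq hα).symm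
  let eβ : Fin b ≃ β := (Finite.equivFinOfCardEq hβ).symm
  let eκ : Fin c ≃ κ := (Finite.equivFinOfCardEq hκ).symm
  refine ⟨fun s i j => M (eκ s) (eα i) (eβ j), ?_, ⟨ω, fun s i => ?_⟩, ⟨δ, fun s j => ?_⟩⟩
  · exact hM.comp (eκ.prodCongr (eα.prodCongr eβ)).bijective
  · rw [← hω (eκ s) (eα i)]
    exact eβ.sum_comp fun j => M (eκ s) (eα i) j
  · rw [← hδ (eκ s) (eβ j)]
    exact eα.sum_comp fun i => M (eκ s) i (eβ j)

theorem exists_isGroupMagicRectangleSet_of_injective [Finite Γ] {κ α β : Type*} [Finite κ]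
    [Fintype α] [Fintype β] {a b c : ℕ} (hκ : Nat.card κ = c) (hα : Nat.card α = a)
    (hβ : Nat.card β = b) (hΓ : Nat.card Γ = a * b * c) (M : κ → α → β → Γ)
    (hM : ∀ s i j s' i' j', M s i j = M s' i' j' → s = s' ∧ i = i' ∧ j = j')
    {ω δ : Γ} (hω : ∀ s i, ∑ j, M s i j = ω) (hδ : ∀ s j, ∑ i, M s i j = δ) :
    ∃ N : Fin c → Fin a → Fin b → Γ, IsGroupMagicRectangleSet Γ a b c N := by
  refine exists_isGroupMagicRectangleSet_of_bijective hα hβ hΓ M ?_ hω hδ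
  rw [Nat.bijective_iff_injective_and_card]
  refine ⟨?_, ?_⟩
  · rintro ⟨s, i, j⟩ ⟨s', i', j'⟩ h
    obtain ⟨rfl, rfl, rfl⟩ := hM _ _ _ _ _ _ h
    rfl
  · rw [Nat.card_prod, Nat.card_prod, hκ, hα, hβ, hΓ, mul_comm]

/-- Small arrays can be put together, `m × n` at a time, to form larger ones. -/
theorem IsGroupMagicRectangleSet.exists_blocks [Finite Γ] {a b c m n : ℕ}
    (h : ∃ M : Fin (m * n * c) → Fin a → Fin b → Γ, IsGroupMagicRectangleSet Γ a b (m * n * c) M)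
    (hΓ : Nat.card Γ = (a * m) * (b * n) * c) :
    ∃ M : Fin c → Fin (a * m) → Fin (b * n) → Γ,
      IsGroupMagicRectangleSet Γ (a * m) (b * n) c M := by
  obtain ⟨M, hM, ⟨ω, hω⟩, ⟨δ, hδ⟩⟩ := h
  let e : (Fin m × Fin n) × Fin c ≃ Fin (m * n * c) :=
    (finProdFinEquiv.prodCongr (Equiv.refl _)).trans finProdFinEquiv
  refine exists_isGroupMagicRectangleSet_of_injective (κ := Fin c) (α := Fin a × Fin m)
    (β := Fin b × Fin n) (by simp) (by simp) (by simp) hΓ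
    (fun s i j => M (e ((i.2, j.2), s)) i.1 j.1) ?_ (ω := n • ω) (δ := m • δ) ?_ ?_
  · rintro s ⟨i, k⟩ ⟨j, l⟩ s' ⟨i', k'⟩ ⟨j', l'⟩ hh
    have := @hM.1 (e ((k, l), s), i, j) (e ((k', l'), s'), i', j') hh
    simp only [Prod.mk.injEq, EmbeddingLike.apply_eq_iff_eq] at this
    grind
  · intro s i
    simp [Fintype.sum_prod_type_right, hω]
  · intro s j
    simp [Fintype.sum_prod_type_right, hδ]

end Indexing

/-! ### Parity constraints from integer magic rectangles -/

section Parity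

/-- With N = abc, double counting gives 2δ = b(N + 1) and 2η = a(N + 1). If N is even, both `a` and
`b` must be even; otherwise all three factors are odd. -/
theorem IsMagicRectangleSet.even_or_odd {a b c : ℕ} {M : Fin c → Fin a → Fin b → ℕ}
    (hM : IsMagicRectangleSet a b c M) (ha : 0 < a) (hb : 0 < b) (hc : 0 < c) :
    (Even a ∧ Even b) ∨ (Odd a ∧ Odd b ∧ Odd c) := by
  obtain ⟨hbij, ⟨δ, hδ⟩, ⟨η, hη⟩⟩ := hM
  have htot : ∑ p : Fin c × Fin a × Fin b, M p.1 p.2.1 p.2.2 = ∑ k ∈ Finset.Icc 1 (a * b * c), k := by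
    refine Finset.sum_nbij (fun p => M p.1 p.2.1 p.2.2) ?_ ?_ ?_ fun _ _ => rfl
    · intro p _
      have := hbij.mapsTo (Set.mem_univ p)
      simpa using this
    · simpa using hbij.injOn
    · simpa using hbij.surjOn
  have hgauss : (∑ k ∈ Finset.Icc 1 (a * b * c), k) * 2 = (a * b * c) * (a * b * c + 1) := by
    have h1 := Finset.sum_range_id_mul_two (a * b * c + 1)
    have h2 : ∑ k ∈ Finset.Icc 1 (a * b * c), k = ∑ k ∈ Finset.range (a * b * c + 1), k := by
      rw [Finset.range_eq_Ico, Finset.sum_eq_sum_Ico_succ_bot (by positivity)]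
      simp only [zero_add]
      rfl
    rw [h2, h1]
    simp [mul_comm]
  have hrow : ∑ p : Fin c × Fin a × Fin b, M p.1 p.2.1 p.2.2 = c * a * δ := by
    simp [Fintype.sum_prod_type, hδ, mul_assoc]
  have hcol : ∑ p : Fin c × Fin a × Fin b, M p.1 p.2.1 p.2.2 = c * b * η := by
    simp only [Fintype.sum_prod_type]
    simp_rw [Finset.sum_comm (s := (Finset.univ : Finset (Fin a)))]
    simp [hη, mul_assoc]
  have h1 : δ * 2 = b * (a * b * c + 1) := by
    refine Nat.eq_of_mul_eq_mul_left (show 0 < c * a by positivity) ?_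
    rw [← mul_assoc, ← hrow, htot, hgauss]
    ring
  have h2 : η * 2 = a * (a * b * c + 1) := by
    refine Nat.eq_of_mul_eq_mul_left (show 0 < c * b by positivity) ?_
    rw [← mul_assoc, ← hcol, htot, hgauss]
    ring
  have e1 : Even (b * (a * b * c + 1)) := h1 ▸ even_two.mul_left _
  have e2 : Even (a * (a * b * c + 1)) := h2 ▸ even_two.mul_left _
  simp only [Nat.even_mul, Nat.even_add_one, ← Nat.not_even_iff_odd] at *
  tauto

end Parity

/-! ### Even sides: 2 × 2 arrays from a free involutive action -/

section Even

variable {Γ : Type*} [AddCommGroup Γ] [Finite Γ]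

/-- If `4` divides the order of `Γ`, then there are an involution `t` and an element `d` such that
neither `d` nor `d + t` is divisible by `2`. -/
theorem exists_involution_of_four_dvd_card (h4 : 4 ∣ Nat.card Γ) :
    ∃ d t : Γ, t ≠ 0 ∧ t + t = 0 ∧ (∀ x, x + x ≠ d) ∧ ∀ x, x + x ≠ d + t := by
  let D : Γ →+ Γ := nsmulAddMonoidHom 2
  have hD : ∀ x, D x = x + x := fun x => two_nsmul x
  have hKR : Nat.card D.ker * Nat.card D.range = Nat.card Γ := by
    rw [← AddSubgroup.index_ker, AddSubgroup.card_mul_index]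
  have key : ∃ d t : Γ, t ≠ 0 ∧ t + t = 0 ∧ d ∉ D.range ∧ d + t ∉ D.range := by
    have hprime : Fact (Nat.Prime 2) := ⟨Nat.prime_two⟩
    have hinv : ∀ H : AddSubgroup Γ, 2 ∣ Nat.card H → ∃ t ∈ H, t ≠ 0 ∧ t + t = 0 := by
      intro H hH
      obtain ⟨t, ht⟩ := exists_prime_addOrderOf_dvd_card' 2 hH
      refine ⟨t, t.2, ?_, ?_⟩
      · rintro h
        rw [ZeroMemClass.coe_eq_zero.1 h, addOrderOf_zero] at ht
        omega
      · have := addOrderOf_nsmul_eq_zero t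
        rw [ht, two_nsmul] at this
        exact_mod_cast congrArg Subtype.val this
    have hR : 0 < Nat.card D.range := Nat.card_pos
    have hK : 2 ∣ Nat.card D.ker := by
      obtain ⟨t, -, ht, ht'⟩ := hinv ⊤ (by
        rw [AddSubgroup.card_top]; exact (by norm_num : 2 ∣ 4).trans h4)
      have hmem : t ∈ D.ker := by rw [AddMonoidHom.mem_ker, hD, ht']
      have : addOrderOf (⟨t, hmem⟩ : D.ker) = 2 := by
        refine addOrderOf_eq_prime ?_ ?_
        · ext; simpa [two_nsmul] using ht'
        · simpa [Subtype.ext_iff] using ht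
      rw [← this]
      exact addOrderOf_dvd_natCard _
    -- If 2Γ contains an involution t, then d and d + t lie in the same coset of 2Γ, so any d
    -- outside 2Γ works. Otherwise 2Γ has odd order, hence index at least 4, and the two translates
    -- 2Γ and 2Γ - t cannot cover `Γ`.
    by_cases h2 : 2 ∣ Nat.card D.range
    · obtain ⟨t, htR, ht, ht'⟩ := hinv _ h2
      have : D.range ≠ ⊤ := by
        intro h
        have hc := hKR
        rw [h, AddSubgroup.card_top] at hc
        have : 0 < Nat.card Γ := Nat.card_pos
        have : Nat.card D.ker = 1 := Nat.eq_of_mul_eq_mul_right this (by simpa using hc)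
        omega
      obtain ⟨d, hd⟩ : ∃ d, d ∉ D.range := by
        by_contra! h
        exact this ((AddSubgroup.eq_top_iff' _).2 h)
      exact ⟨d, t, ht, ht', hd, fun h => hd ((D.range.add_mem_cancel_right htR).1 h)⟩
    · have hK4 : 4 ∣ Nat.card D.ker := by
        refine Nat.Coprime.dvd_of_dvd_mul_right (n := Nat.card D.range) ?_ (hKR ▸ h4)
        exact Nat.Coprime.pow_left 2 ((Nat.prime_two.coprime_iff_not_dvd).2 h2)
      obtain ⟨t, -, ht, ht'⟩ := hinv D.ker hK
      have hlt : (((D.range : Set Γ) ∪ (fun x => x - t) '' (D.range : Set Γ))).ncard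
          < (Set.univ : Set Γ).ncard := by
        refine (Set.ncard_union_le _ _).trans_lt ?_
        have := Set.ncard_image_le (f := fun x => x - t) (Set.toFinite (D.range : Set Γ))
        have h1 : (D.range : Set Γ).ncard = Nat.card D.range := rfl
        rw [Set.ncard_univ, ← hKR]
        have : 4 ≤ Nat.card D.ker := Nat.le_of_dvd Nat.card_pos hK4
        nlinarith
      obtain ⟨d, -, hd⟩ := Set.exists_mem_notMem_of_ncard_lt_ncard hlt
      refine ⟨d, t, ht, ht', fun h => hd (Or.inl h), fun h => hd (Or.inr ⟨d + t, h, by simp⟩)⟩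
  obtain ⟨d, t, ht, ht', hd, hdt⟩ := key
  exact ⟨d, t, ht, ht', fun x hx => hd ⟨x, by rw [hD, hx]⟩, fun x hx => hdt ⟨x, by rw [hD, hx]⟩⟩

/-- Each array is an orbit of the group generated by x ↦ x + t and x ↦ d - x. An orbit degenerates
only if some 2x equals d or d + t, which the choice of d excludes. Rows sum to d + t, columns to d
since 2t = 0. -/
theorem exists_isGroupMagicRectangleSet_two_two {c : ℕ} (hΓ : Nat.card Γ = 2 * 2 * c) :
    ∃ M : Fin c → Fin 2 → Fin 2 → Γ, IsGroupMagicRectangleSet Γ 2 2 c M := by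
  obtain ⟨d, t, ht, ht', hd, hdt⟩ := exists_involution_of_four_dvd_card (Γ := Γ) ⟨c, hΓ⟩
  have htneg : -t = t := neg_eq_of_add_eq_zero_left ht'
  let S : Setoid Γ :=
    { r := fun x y => y = x ∨ y = d + t - x ∨ y = d - x ∨ y = x + t
      iseqv := by
        refine ⟨fun x => Or.inl rfl, fun {x y} h => ?_, fun {x y z} h h' => ?_⟩
        · rcases h with rfl | rfl | rfl | rfl
          · exact Or.inl rfl
          · right; left; abel
          · right; right; left; abel
          · right; right; right; rw [add_assoc, ht', add_zero]
        · have hsub (u : Γ) : u - t = u + t := by rw [sub_eq_add_neg, htneg]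
          have htt (u : Γ) : u + t + t = u := by rw [add_assoc, ht', add_zero]
          rcases h with rfl | rfl | rfl | rfl <;> rcases h' with rfl | rfl | rfl | rfl <;>
            simp [add_sub_right_comm, sub_add_eq_sub_sub, hsub, htt] }
  let op : Fin 2 → Fin 2 → Γ → Γ := fun i j x => !![x, d + t - x; d - x, x + t] i j
  have hop : ∀ i j x, S.r x (op i j x) := by
    intro i j x
    fin_cases i <;> fin_cases j
    · exact Or.inl rfl
    · exact Or.inr (Or.inl rfl)
    · exact Or.inr (Or.inr (Or.inl rfl))
    · exact Or.inr (Or.inr (Or.inr rfl))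
  have hinj : ∀ x i j i' j', op i j x = op i' j' x → i = i' ∧ j = j' := by
    intro x i j i' j'
    have h1 := hd x
    have h2 := hdt x
    have h3 : x + t + x ≠ d := fun h => h2 (by
      rw [← h, add_right_comm, add_assoc _ t t, ht', add_zero])
    have h4 : x + t + x ≠ d + t := fun h => h1 (add_right_cancel (by rw [← h, add_right_comm]))
    fin_cases i <;> fin_cases j <;> fin_cases i' <;> fin_cases j' <;>
      simp [op, eq_sub_iff_add_eq, sub_eq_iff_eq_add, ht, h1, h2, h3, h1.symm, h2.symm, h3.symm, h4, h4.symm]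
  refine exists_isGroupMagicRectangleSet_of_bijective (κ := Quotient S) (α := Fin 2) (β := Fin 2)
    (by simp) (by simp) hΓ (fun s i j => op i j s.out) ⟨?_, ?_⟩ (ω := d + t) (δ := d) ?_ ?_
  · rintro ⟨s, i, j⟩ ⟨s', i', j'⟩ h
    have hs : s = s' := by
      rw [← s.out_eq, ← s'.out_eq]
      refine Quotient.sound (S.trans (hop i j _) ?_)
      have h' : op i j s.out = op i' j' s'.out := h
      rw [h']
      exact S.symm (hop _ _ _)
    subst hs
    obtain ⟨rfl, rfl⟩ := hinj _ _ _ _ _ h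
    rfl
  · intro y
    have h : S.r (Quotient.out (Quotient.mk S y)) y := Quotient.mk_out y
    rcases h with h | h | h | h
    · exact ⟨(Quotient.mk S y, 0, 0), h.symm⟩
    · exact ⟨(Quotient.mk S y, 0, 1), h.symm⟩
    · exact ⟨(Quotient.mk S y, 1, 0), h.symm⟩
    · exact ⟨(Quotient.mk S y, 1, 1), h.symm⟩
  · intro s i
    fin_cases i <;> simp [op]
    abel
  · intro s j
    fin_cases j <;> simp [op]
    rw [← add_assoc, sub_add_cancel, add_assoc, ht', add_zero]

end Even

/-! ### Odd sides: Kotzig arrays and prime-sided rectangles -/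

section Odd

variable {Γ : Type*} [AddCommGroup Γ] [Finite Γ]

theorem Module.exists_addMonoidHom_surjective (K V : Type*) [Field K] [AddCommGroup V] [Module K V]
    [Nontrivial V] : ∃ f : V →+ K, Function.Surjective f := by
  obtain ⟨v, hv⟩ := exists_ne (0 : V)
  obtain ⟨f, hf⟩ : ∃ f : V →ₗ[K] K, f v ≠ 0 := by
    by_contra! h
    exact hv ((Module.forall_dual_apply_eq_zero_iff K v).1 h)
  exact ⟨f.toAddMonoidHom, f.surjective (by rintro rfl; exact hf rfl)⟩

/-- By Cauchy, multiplication by r is not injective, hence not surjective. So Γ/rΓ is a nonzero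
vector space over `ZMod r` and has a nonzero functional. -/
theorem AddCommGroup.exists_surjective_zmod {r : ℕ} [Fact r.Prime] (hr : r ∣ Nat.card Γ) :
    ∃ φ : Γ →+ ZMod r, Function.Surjective φ := by
  let H : AddSubgroup Γ := (nsmulAddMonoidHom (α := Γ) r).range
  let : Module (ZMod r) (Γ ⧸ H) := QuotientAddGroup.zmodModule fun x => ⟨x, rfl⟩
  have hH : ∃ x, x ∉ H := by
    by_contra! h
    have hinj : Function.Injective (nsmulAddMonoidHom (α := Γ) r) :=
      Finite.injective_iff_surjective.2 h
    obtain ⟨x, hx⟩ := exists_prime_addOrderOf_dvd_card' r hr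
    have hx0 : x = 0 := hinj (by
      have := addOrderOf_nsmul_eq_zero x
      rw [hx] at this
      simpa using this)
    rw [hx0, addOrderOf_zero] at hx
    exact (Fact.out : r.Prime).one_lt.ne hx
  obtain ⟨x, hx⟩ := hH
  have hx0 : (QuotientAddGroup.mk x : Γ ⧸ H) ≠ 0 := fun h => hx ((QuotientAddGroup.eq_zero_iff x).1 h)
  have : Nontrivial (Γ ⧸ H) := ⟨_, _, hx0⟩
  obtain ⟨f, hf⟩ := Module.exists_addMonoidHom_surjective (ZMod r) (Γ ⧸ H)
  exact ⟨f.comp (QuotientAddGroup.mk' H), hf.comp (QuotientAddGroup.mk'_surjective H)⟩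

theorem AddMonoidHom.card_ker_mul {G : Type*} [AddCommGroup G] {r : ℕ} {φ : G →+ ZMod r}
    (hφ : Function.Surjective φ) : Nat.card φ.ker * r = Nat.card G := by
  rw [← AddSubgroup.card_mul_index φ.ker, AddSubgroup.index_ker,
    AddMonoidHom.range_eq_top.2 hφ, AddSubgroup.card_top, Nat.card_zmod]

theorem ZMod.valMinAbs_neg_of_odd {r : ℕ} (hr : Odd r) (x : ZMod r) :
    (-x).valMinAbs = -x.valMinAbs :=
  ZMod.valMinAbs_neg_of_ne_half fun h => by
    rw [← h] at hr
    exact Nat.not_odd_iff_even.2 (even_two_mul _) hr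

/-- Adding m, half the modulus rounded down, moves a representative y to y + m if y ≤ 0 and to y - m
- 1 if y > 0. In both cases adding y again stays within [-m, m], so nothing wraps around. -/
theorem ZMod.valMinAbs_add_add_half {m : ℕ} (t : ZMod (2 * m + 1)) :
    (2 * t + m).valMinAbs = t.valMinAbs + (t + m).valMinAbs := by
  have ht := t.valMinAbs_mem_Ioc
  have hc := t.coe_valMinAbs
  simp only [Set.mem_Ioc] at ht
  push_cast at ht
  have hm : (2 * m + 1 : ZMod (2 * m + 1)) = 0 := by
    have := ZMod.natCast_self (2 * m + 1)
    push_cast at this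
    exact this
  set y := t.valMinAbs
  rcases le_or_gt y 0 with hy | hy
  · have h1 : (t + m).valMinAbs = y + m := by
      rw [ZMod.valMinAbs_spec]
      refine ⟨by push_cast; rw [hc], ?_⟩
      simp only [Set.mem_Ioc]
      push_cast
      omega
    rw [h1, ZMod.valMinAbs_spec]
    refine ⟨by push_cast; rw [hc]; ring, ?_⟩
    simp only [Set.mem_Ioc]
    push_cast
    omega
  · have h1 : (t + m).valMinAbs = y - m - 1 := by
      rw [ZMod.valMinAbs_spec]
      refine ⟨by push_cast; rw [hc]; linear_combination hm, ?_⟩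
      simp only [Set.mem_Ioc]
      push_cast
      omega
    rw [h1, ZMod.valMinAbs_spec]
    refine ⟨by push_cast; rw [hc]; linear_combination hm, ?_⟩
    simp only [Set.mem_Ioc]
    push_cast
    omega

/-- Three permutations of `ZMod r` whose symmetric representatives sum to zero pointwise. -/
theorem ZMod.exists_injective_sum_valMinAbs_eq_zero {r : ℕ} (hr : Odd r) :
    ∃ π : ZMod 3 → ZMod r → ZMod r, (∀ k, Function.Injective (π k)) ∧
      ∀ t, ∑ k, (π k t).valMinAbs = 0 := by
  obtain ⟨m, rfl⟩ := hr
  have h2 : IsUnit (2 : ZMod (2 * m + 1)) := by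
    have := (ZMod.isUnit_iff_coprime 2 (2 * m + 1)).2 (by simp)
    exact_mod_cast this
  refine ⟨fun k t => if k = 0 then t else if k = 1 then t + m else -(2 * t + m), ?_, fun t => ?_⟩
  · intro k x y h
    dsimp only at h
    split_ifs at h
    · exact h
    · simpa using h
    · exact h2.mul_left_cancel (by simpa using h)
  · have hu : (Finset.univ : Finset (ZMod 3)) = {0, 1, 2} := by decide
    have h10 : (1 : ZMod 3) ≠ 0 := by decide
    have h20 : (2 : ZMod 3) ≠ 0 := by decide
    have h21 : (2 : ZMod 3) ≠ 1 := by decide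
    rw [hu, Finset.sum_insert (by decide), Finset.sum_insert (by decide), Finset.sum_singleton]
    simp only [h10, h20, h21, if_true, if_false]
    rw [ZMod.valMinAbs_neg_of_odd ⟨m, rfl⟩, ZMod.valMinAbs_add_add_half]
    ring

/-- A three-dimensional Kotzig array: a rectangle of permutations of `ZMod r`, whose symmetric
representatives sum to zero along each row and each column. -/
theorem ZMod.exists_kotzig_array {r : ℕ} (hr : Odd r) (k l : ℕ) :
    ∃ K : ZMod 3 ⊕ Fin k × Bool → ZMod 3 ⊕ Fin l × Bool → ZMod r → ZMod r,
      (∀ i j, Function.Injective (K i j)) ∧ (∀ i t, ∑ j, (K i j t).valMinAbs = 0) ∧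
      ∀ j t, ∑ i, (K i j t).valMinAbs = 0 := by
  obtain ⟨π, hπ, hsum⟩ := ZMod.exists_injective_sum_valMinAbs_eq_zero hr
  let S : Bool → ZMod r → ZMod r := fun b x => bif b then x else -x
  have hS : ∀ b, Function.Injective (S b) := by
    intro b x y h
    cases b <;> simpa [S] using h
  have hS0 : ∀ x, ∑ b, (S b x).valMinAbs = 0 := by
    intro x
    simp [S, ZMod.valMinAbs_neg_of_odd hr]
  have hS1 : ∀ b x, (S b x).valMinAbs = (bif b then 1 else -1) * x.valMinAbs := by
    intro b x
    cases b <;> simp [S, ZMod.valMinAbs_neg_of_odd hr]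
  -- A 3 × 3 cyclic Latin block of the π's, bordered by ± pairs: sums vanish over the three π's in
  -- the core and by sign cancellation in the border.
  refine ⟨fun i j => Sum.elim
    (fun i => Sum.elim (fun j => π (i + j)) (fun j => S j.2 ∘ π i) j)
    (fun i => Sum.elim (fun j => S i.2 ∘ π j) (fun j => S j.2 ∘ S i.2) j) i, ?_, ?_, ?_⟩
  · rintro (i | i) (j | j)
    · exact hπ _
    · exact (hS _).comp (hπ _)
    · exact (hS _).comp (hπ _)
    · exact (hS _).comp (hS _)
  · rintro (i | i) t
    · have := Equiv.sum_comp (Equiv.addLeft i) fun k => (π k t).valMinAbs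
      simp only [Equiv.coe_addLeft] at this
      simp [Fintype.sum_prod_type, hS0, this, hsum, -Fintype.univ_bool]
    · simp [Fintype.sum_prod_type, hS0, -Fintype.univ_bool]
      simp [hS1, ← Finset.mul_sum, hsum]
  · rintro (j | j) t
    · have := Equiv.sum_comp (Equiv.addRight j) fun k => (π k t).valMinAbs
      simp only [Equiv.coe_addRight] at this
      simp [Fintype.sum_prod_type, hS0, this, hsum, -Fintype.univ_bool]
    · simp [Fintype.sum_prod_type, hS1, ← Finset.mul_sum, hsum]

/-- Magic rectangle sets extend from a subgroup of prime index to the whole group. -/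
theorem IsGroupMagicRectangleSet.exists_of_ker {a b c r : ℕ} [Fact r.Prime] (ha : Odd a)
    (ha1 : 1 < a) (hb : Odd b) (hb1 : 1 < b) (hr : Odd r) (φ : Γ →+ ZMod r)
    (hφ : Function.Surjective φ) (hΓ : Nat.card Γ = a * b * (c * r))
    (h : ∃ M : Fin c → Fin a → Fin b → φ.ker, IsGroupMagicRectangleSet φ.ker a b c M) :
    ∃ M : Fin (c * r) → Fin a → Fin b → Γ, IsGroupMagicRectangleSet Γ a b (c * r) M := by
  obtain ⟨k, rfl⟩ : ∃ k, a = 3 + k * 2 := by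
    obtain ⟨m, rfl⟩ := ha
    exact ⟨m - 1, by omega⟩
  obtain ⟨l, rfl⟩ : ∃ l, b = 3 + l * 2 := by
    obtain ⟨m, rfl⟩ := hb
    exact ⟨m - 1, by omega⟩
  obtain ⟨M, hM, ⟨ω, hω⟩, ⟨δ, hδ⟩⟩ := h
  obtain ⟨K, hK, hrow, hcol⟩ := ZMod.exists_kotzig_array hr k l
  obtain ⟨g, hg⟩ := hφ 1
  have hcα : ∀ k : ℕ, Nat.card (ZMod 3 ⊕ Fin k × Bool) = 3 + k * 2 := by
    intro k
    simp
  let eα := Finite.equivFinOfCardEq (hcα k)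
  let eβ := Finite.equivFinOfCardEq (hcα l)
  -- As g need not have order r, zero sums in `ZMod r` would not suffice; the integer
  -- representatives in K sum to zero exactly. An entry is decoded by φ, which gives the value of K,
  -- then by `M`, which gives the cell, then by injectivity of K at that cell.
  refine exists_isGroupMagicRectangleSet_of_injective (κ := Fin c × ZMod r) (by simp) (hcα k)
    (hcα l) hΓ (fun s i j => (M s.1 (eα i) (eβ j) : Γ) + (K i j s.2).valMinAbs • g)
    ?_ (ω := ω) (δ := δ) ?_ ?_
  · rintro ⟨s, t⟩ i j ⟨s', t'⟩ i' j' heq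
    have hφM : ∀ s i j, φ (M s i j : Γ) = 0 := fun s i j => (M s i j).2
    have h1 := congrArg φ heq
    simp only [map_add, map_zsmul, hg, hφM, zero_add, zsmul_one, ZMod.coe_valMinAbs] at h1
    simp only [h1, add_left_inj, SetLike.coe_eq_coe] at heq
    have h2 := @hM.1 (s, eα i, eβ j) (s', eα i', eβ j') heq
    simp only [Prod.mk.injEq, EmbeddingLike.apply_eq_iff_eq] at h2
    obtain ⟨rfl, rfl, rfl⟩ := h2
    obtain rfl := hK i j h1
    exact ⟨rfl, rfl, rfl⟩
  · intro s i
    rw [Finset.sum_add_distrib, ← Finset.sum_smul, hrow, zero_smul, add_zero,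
      eβ.sum_comp fun j => (M s.1 (eα i) j : Γ), ← hω s.1 (eα i)]
    simp
  · intro s j
    rw [Finset.sum_add_distrib, ← Finset.sum_smul, hcol, zero_smul, add_zero,
      eα.sum_comp fun i => (M s.1 i (eβ j) : Γ), ← hδ s.1 (eβ j)]
    simp

/-- The differences i - j index the kernel of φ and the sums i + j index its cosets. Each runs once
through `ZMod p` along every line, and together they determine (i, j) because 2 is invertible. No
splitting of `Γ` is needed. -/
theorem exists_isGroupMagicRectangleSet_prime_sq {p : ℕ} [Fact p.Prime] (hp : Odd p)
    (hΓ : Nat.card Γ = p * p * 1) :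
    ∃ M : Fin 1 → Fin p → Fin p → Γ, IsGroupMagicRectangleSet Γ p p 1 M := by
  have hp0 : 0 < p := (Fact.out : p.Prime).pos
  obtain ⟨φ, hφ⟩ := AddCommGroup.exists_surjective_zmod (Γ := Γ) (r := p) (by
    rw [hΓ, mul_one]; exact dvd_mul_right p p)
  obtain ⟨g, hg⟩ := hφ 1
  have hker : Nat.card φ.ker = p := by
    have h := AddMonoidHom.card_ker_mul hφ
    rw [hΓ, mul_one] at h
    exact Nat.eq_of_mul_eq_mul_right hp0 h
  obtain ⟨e⟩ : Nonempty (ZMod p ≃ φ.ker) :=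
    (Finite.card_eq).1 (by rw [hker, Nat.card_zmod])
  have h2 : IsUnit (2 : ZMod p) := by
    have := (ZMod.isUnit_iff_coprime 2 p).2 (Nat.coprime_two_left.2 hp)
    exact_mod_cast this
  refine exists_isGroupMagicRectangleSet_of_injective (κ := Unit) (α := ZMod p) (β := ZMod p)
    (by simp) (by simp) (by simp) hΓ
    (fun _ i j => (e (i - j) : Γ) + (i + j).valMinAbs • g) ?_
    (ω := ∑ x, (e x : Γ) + (∑ x : ZMod p, x.valMinAbs) • g)
    (δ := ∑ x, (e x : Γ) + (∑ x : ZMod p, x.valMinAbs) • g) ?_ ?_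
  · rintro - i j - i' j' heq
    have he : ∀ x, φ (e x : Γ) = 0 := fun x => (e x).2
    have h1 := congrArg φ heq
    simp only [map_add, map_zsmul, hg, he, zero_add, zsmul_one, ZMod.coe_valMinAbs] at h1
    simp only [h1, add_left_inj, SetLike.coe_eq_coe, EmbeddingLike.apply_eq_iff_eq] at heq
    have hi : i = i' := h2.mul_left_cancel (by linear_combination h1 + heq)
    exact ⟨rfl, hi, by linear_combination h1 - hi⟩
  · intro _ i
    rw [Finset.sum_add_distrib, ← Finset.sum_smul]
    congr 1
    · exact Equiv.sum_comp (Equiv.subLeft i) fun x => (e x : Γ)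
    · exact congrArg (· • g) (Equiv.sum_comp (Equiv.addLeft i) ZMod.valMinAbs)
  · intro _ j
    rw [Finset.sum_add_distrib, ← Finset.sum_smul]
    congr 1
    · exact Equiv.sum_comp (Equiv.subRight j) fun x => (e x : Γ)
    · exact congrArg (· • g) (Equiv.sum_comp (Equiv.addRight j) ZMod.valMinAbs)

theorem ZMod.exists_even_ne_zero_sum_eq_zero {p q : ℕ} [Fact p.Prime] [Fact q.Prime]
    (hp : Odd p) (hq : Odd q) (hpq : p ≠ q) :
    ∃ w : ZMod p → ZMod q, (∀ i, w i ≠ 0) ∧ (∀ i, w (-i) = w i) ∧ ∑ i, w i = 0 := by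
  have h2q : (2 : ZMod q) ≠ 0 := by
    have := ZMod.prime_ne_zero q 2 (by rintro rfl; exact absurd hq (by decide))
    exact_mod_cast this
  have h2p : (2 : ZMod p) ≠ 0 := by
    have := ZMod.prime_ne_zero p 2 (by rintro rfl; exact absurd hp (by decide))
    exact_mod_cast this
  -- Correcting the constant 1 at the origin gives w(0) = 1 - p, which fails only if p = 1 in `ZMod
  -- q`. In that case take w(0) = 4, w(±1) = -1 and 1 elsewhere, with sum p - 1 = 0.
  by_cases h1 : (p : ZMod q) = 1
  · have h11 : (1 : ZMod p) ≠ -1 := fun h => h2p (by linear_combination h)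
    refine ⟨fun i => 1 + (if i = 0 then 3 else 0) + (if i = 1 then -2 else 0) +
      (if i = -1 then -2 else 0), fun i => ?_, fun i => ?_, ?_⟩
    · by_cases hi0 : i = 0
      · simp only [hi0, if_true, zero_ne_one, if_false, (neg_ne_zero.2 one_ne_zero).symm]
        intro h
        exact mul_ne_zero h2q h2q (by linear_combination h)
      by_cases hi1 : i = 1
      · simp only [hi1, one_ne_zero, if_true, if_false, h11]
        intro h
        exact one_ne_zero (α := ZMod q) (by linear_combination -h)
      by_cases hi2 : i = -1
      · simp only [hi2, neg_eq_zero, one_ne_zero, if_true, if_false, h11.symm]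
        intro h
        exact one_ne_zero (α := ZMod q) (by linear_combination -h)
      · simp [hi0, hi1, hi2]
    · simp only [neg_eq_zero, neg_inj, neg_eq_iff_eq_neg (b := (1 : ZMod p))]
      ring
    · simp only [Finset.sum_add_distrib, Finset.sum_ite_eq', Finset.mem_univ, if_true]
      simp [h1]
      ring
  · refine ⟨fun i => 1 + if i = 0 then -(p : ZMod q) else 0, fun i => ?_, fun i => by simp, ?_⟩
    · by_cases hi0 : i = 0
      · simp only [hi0, if_true]
        exact fun h => h1 (by linear_combination -h)
      · simp [hi0]
    · simp [Finset.sum_add_distrib]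

theorem ZMod.sum_eq_zero_of_odd {p n : ℕ} [NeZero p] (hn : Odd n) (f : ZMod p → ZMod n)
    (hf : ∀ x, f (-x) = -f x) : ∑ x, f x = 0 := by
  have h : ∑ x, f x = -∑ x, f x := by
    rw [← Finset.sum_neg_distrib, ← Equiv.sum_comp (Equiv.neg (ZMod p))]
    simp [hf]
  have h2 : IsUnit (2 : ZMod n) := by
    have := (ZMod.isUnit_iff_coprime 2 n).2 (Nat.coprime_two_left.2 hn)
    exact_mod_cast this
  exact h2.mul_left_cancel (by linear_combination h)

/-- In ZMod p × ZMod q the cell (i, j) holds (u(y)·i, y) with y = v(i)·j; nonvanishing of u and v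
recovers i, then j. Along a row y permutes `ZMod q`, so the sum is zero because ∑ u = 0. Along a
column ∑ v = 0 settles the second coordinate, and the first is an odd function of i because v is
even. -/
theorem exists_isGroupMagicRectangleSet_prime_mul_prime {p q : ℕ} [Fact p.Prime] [Fact q.Prime]
    (hp : Odd p) (hq : Odd q) (hpq : p ≠ q) (hΓ : Nat.card Γ = p * q * 1) :
    ∃ M : Fin 1 → Fin p → Fin q → Γ, IsGroupMagicRectangleSet Γ p q 1 M := by
  obtain ⟨v, hv0, hveven, hvsum⟩ := ZMod.exists_even_ne_zero_sum_eq_zero hp hq hpq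
  obtain ⟨u, hu0, -, husum⟩ := ZMod.exists_even_ne_zero_sum_eq_zero hq hp hpq.symm
  obtain ⟨g, hg⟩ := exists_prime_addOrderOf_dvd_card' (G := Γ) p (by rw [hΓ, mul_assoc]; simp)
  obtain ⟨h, hh⟩ := exists_prime_addOrderOf_dvd_card' (G := Γ) q (by
    rw [hΓ, mul_right_comm]; simp)
  let f : ZMod p × ZMod q →+ Γ := AddMonoidHom.coprod
    (ZMod.lift p ⟨zmultiplesHom Γ g, by simp [← hg, addOrderOf_nsmul_eq_zero]⟩)
    (ZMod.lift q ⟨zmultiplesHom Γ h, by simp [← hh, addOrderOf_nsmul_eq_zero]⟩)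
  have hf : Function.Injective f := by
    rw [injective_iff_map_eq_zero]
    rintro ⟨x, y⟩ hxy
    obtain ⟨x, rfl⟩ := ZMod.intCast_surjective x
    obtain ⟨y, rfl⟩ := ZMod.intCast_surjective y
    have hxy' : x • g + y • h = 0 := by simpa [f] using hxy
    have hgmem : x • g = -y • h := by rw [neg_smul]; exact eq_neg_of_add_eq_zero_left hxy'
    have hdis : Disjoint (AddSubgroup.zmultiples g) (AddSubgroup.zmultiples h) :=
      AddSubgroup.disjoint_of_coprime_natCard (by
        rw [Nat.card_zmultiples, Nat.card_zmultiples, hg, hh]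
        exact (Nat.coprime_primes Fact.out Fact.out).2 hpq)
    have hx0 : x • g = 0 := AddSubgroup.disjoint_def.1 hdis
      (AddSubgroup.zsmul_mem_zmultiples g x)
      (hgmem ▸ AddSubgroup.zsmul_mem_zmultiples h (-y))
    have hy0 : y • h = 0 := by simpa [hx0] using hxy'
    rw [← addOrderOf_dvd_iff_zsmul_eq_zero, hg, ← ZMod.intCast_zmod_eq_zero_iff_dvd] at hx0
    rw [← addOrderOf_dvd_iff_zsmul_eq_zero, hh, ← ZMod.intCast_zmod_eq_zero_iff_dvd] at hy0
    simp [hx0, hy0]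
  refine exists_isGroupMagicRectangleSet_of_injective (κ := Unit) (α := ZMod p) (β := ZMod q)
    (by simp) (by simp) (by simp) hΓ (fun _ i j => f (u (v i * j) * i, v i * j)) ?_
    (ω := 0) (δ := 0) ?_ ?_
  · rintro - i j - i' j' heq
    obtain ⟨h1, h2⟩ := Prod.mk.inj (hf heq)
    rw [h2] at h1
    obtain rfl := mul_left_cancel₀ (hu0 _) h1
    exact ⟨rfl, rfl, mul_left_cancel₀ (hv0 _) h2⟩
  · intro _ i
    refine (Equiv.sum_comp (Equiv.mulLeft₀ (v i) (hv0 i)) fun x => f (u x * i, x)).trans ?_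
    rw [← map_sum,
      show ∑ x, (u x * i, x) = 0 from ?_, map_zero]
    refine Prod.ext ?_ ?_
    · rw [Prod.fst_sum, ← Finset.sum_mul, husum, zero_mul, Prod.fst_zero]
    · rw [Prod.snd_sum]
      exact ZMod.sum_eq_zero_of_odd hq (fun x => x) fun _ => rfl
  · intro _ j
    rw [← map_sum, show ∑ i, (u (v i * j) * i, v i * j) = 0 from ?_, map_zero]
    refine Prod.ext ?_ ?_
    · rw [Prod.fst_sum]
      exact ZMod.sum_eq_zero_of_odd hp _ fun i => by rw [hveven, mul_neg]
    · rw [Prod.snd_sum, ← Finset.sum_mul, hvsum, zero_mul, Prod.snd_zero]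

/-- Over groups of odd order there are magic rectangle sets whose arrays have odd prime sides. -/
theorem exists_isGroupMagicRectangleSet_of_odd_prime {p q : ℕ} [Fact p.Prime] [Fact q.Prime]
    (hp : Odd p) (hq : Odd q) {c : ℕ} (hc : Odd c) (Γ : Type*) [AddCommGroup Γ] [Finite Γ]
    (hΓ : Nat.card Γ = p * q * c) :
    ∃ M : Fin c → Fin p → Fin q → Γ, IsGroupMagicRectangleSet Γ p q c M := by
  induction c using induction_on_primes generalizing Γ with
  | zero => exact absurd hc (by decide)
  | one =>
    by_cases hpq : p = q
    · subst hpq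
      exact exists_isGroupMagicRectangleSet_prime_sq hp hΓ
    · exact exists_isGroupMagicRectangleSet_prime_mul_prime hp hq hpq hΓ
  | prime_mul r n hr ih =>
    have : Fact r.Prime := ⟨hr⟩
    obtain ⟨hr2, hn⟩ := Nat.odd_mul.1 hc
    obtain ⟨φ, hφ⟩ := AddCommGroup.exists_surjective_zmod (Γ := Γ) (r := r) (by
      rw [hΓ, mul_left_comm]; exact dvd_mul_right _ _)
    rw [mul_comm r n] at hΓ ⊢
    refine IsGroupMagicRectangleSet.exists_of_ker hp (Fact.out : p.Prime).one_lt hq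
      (Fact.out : q.Prime).one_lt hr2 φ hφ hΓ (ih hn φ.ker ?_)
    rw [← mul_assoc] at hΓ
    exact Nat.eq_of_mul_eq_mul_right hr.pos ((AddMonoidHom.card_ker_mul hφ).trans hΓ)

end Odd

/-! ### Assembly -/

theorem theorem3p6 (a b c : ℕ) (ha : 1 < a) (hb : 4 ≤ b)
    (h : ∃ M : Fin c → Fin a → Fin b → ℕ, IsMagicRectangleSet a b c M)
    (Γ : Type*) [AddCommGroup Γ] [Finite Γ] (hΓ : Nat.card Γ = a * b * c) :
    ∃ M : Fin c → Fin a → Fin b → Γ, IsGroupMagicRectangleSet Γ a b c M := by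
  obtain ⟨N, hN⟩ := h
  have hc : 0 < c := Nat.pos_of_mul_pos_left (hΓ ▸ Nat.card_pos : 0 < a * b * c)
  rcases hN.even_or_odd (by omega) (by omega) hc with ⟨hae, hbe⟩ | ⟨hao, hbo, hco⟩
  · obtain ⟨m, rfl⟩ := even_iff_two_dvd.1 hae
    obtain ⟨n, rfl⟩ := even_iff_two_dvd.1 hbe
    refine IsGroupMagicRectangleSet.exists_blocks ?_ hΓ
    exact exists_isGroupMagicRectangleSet_two_two (by rw [hΓ]; ring)
  · obtain ⟨p, hp, m, rfl⟩ := Nat.exists_prime_and_dvd (n := a) (by omega)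
    obtain ⟨q, hq, n, rfl⟩ := Nat.exists_prime_and_dvd (n := b) (by omega)
    have : Fact p.Prime := ⟨hp⟩
    have : Fact q.Prime := ⟨hq⟩
    rw [Nat.odd_mul] at hao hbo
    refine IsGroupMagicRectangleSet.exists_blocks ?_ hΓ
    exact exists_isGroupMagicRectangleSet_of_odd_prime hao.1 hbo.1 ((hao.2.mul hbo.2).mul hco) Γ
      (by rw [hΓ]; ring)
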